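/- Theorem (Convergence via safeguarding against Q-learning). Let $(\mathcal S,\mathcal A,\mathbb P,c,\gamma)$ be a Markov decision process with finite state space $\mathcal S$, finite nonempty action space $\mathcal A$, transition kernel $\mathbb P(\cdot\mid s,a)$, stage cost $c:\mathcal S\times\mathcal A\to\mathbb R$ and discount factor $\gamma\in(0,1)$. For a policy $\pi:\mathcal S\to\mathcal A$ let $$v^\pi(s)=\mathbb E\Big[\sum_{t=0}^\infty\gamma^t c(s_t,\pi(s_t))\,\Big|\,s_0=s,\ s_{t+1}\sim\mathbb P(\cdot\mid s_t,\pi(s_t))\Big],\qquad q^\pi(s,a)=c(s,a)+\gamma\,\mathbb E_{s^+\sim\mathbb P(\cdot\mid s,a)}[v^\pi(s^+)],$$ and let $q^\star=\min_\pi q^\pi$ (entrywise) be the optimal Q-function. For $q\in\mathbb R^{\mathcal S\times\mathcal A}$ and $\varsigma^+\in\mathcal S^{\mathcal S\times\mathcal A}$ define the sampled Bellman optimality operator $$[\widehat T(q,\varsigma^+)](s,a)=c(s,a)+\gamma\min_{a^+\in\mathcal A}q\big(\varsigma^+(s,a),a^+\big),$$ and, for $\rho>0$, define $B_\rho(p)=\frac{\min\{\rho,\|p\|_\infty\}}{\|p\|_\infty}\,p$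 for $p\neq0$ and $B_\rho(0)=0$. Let $\varsigma^+_0,\varsigma^+_1,\dots$ be independent random vectors in $\mathcal S^{\mathcal S\times\mathcal A}$ with $\varsigma^+_k(s,a)\sim\mathbb P(\cdot\mid s,a)$ for all $k$ and $(s,a)$. Let $\rho>0$, and let $\alpha_k\ge0$ and $\beta_k\in\mathbb R$ be deterministic sequences with $\sum_k\alpha_k=\infty$, $\sum_k\alpha_k^2<\infty$ and $\beta_k\to0$. Let $q_0$ be an arbitrary (possibly random) initial vector and $(b_k)_{k\ge0}$ an arbitrary sequence of (possibly random, history- and sample-dependent) vectors in $\mathbb R^{\mathcal S\times\mathcal A}$, and for $k\ge0$ let $$p_k=b_k+q_k-\widehat T(q_k,\varsigma^+_k),\qquad q_{k+1}=q_k+\alpha_k\big(\widehat T(q_k,\varsigma^+_k)-q_k+\beta_kB_\rho(p_k)\big).$$ Then $q_k\to q^\star$ almost surely. -/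

import Mathlib

open MeasureTheory ProbabilityTheory Filter Topology

/-- A discounted Markov decision process with state space `S` and action space `A`: a transition
probability kernel, a stage cost and a discount factor in `(0, 1)`. -/
structure MDP (S A : Type*) [MeasurableSpace S] [MeasurableSpace A] where
  /-- `P (s, a)` is the law of the next state when action `a` is taken in state `s`. -/
  P : Kernel (S × A) S
  isMarkov : IsMarkovKernel P
  /-- The stage cost. -/
  c : S → A → ℝ
  /-- The discount factor. -/
  γ : ℝ
  γ_pos : 0 < γ
  γ_lt_one : γ < 1

attribute [instance] MDP.isMarkov

namespace MDP

variable {S A : Type*} [MeasurableSpace S] [MeasurableSpace A]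

/-- The transition from the history `s₀, …, sₙ` to `sₙ₊₁` under the stationary policy `π`:
the next state has law `P (sₙ, π sₙ)`. -/
noncomputable def stepKernel [DiscreteMeasurableSpace S] (M : MDP S A) (π : S → A) (n : ℕ) :
    Kernel ((i : Finset.Iic n) → (fun _ : ℕ => S) i) S :=
  M.P.comap (fun h => (h ⟨n, Finset.mem_Iic.2 le_rfl⟩, π (h ⟨n, Finset.mem_Iic.2 le_rfl⟩)))
    ((Measurable.of_discrete (f := fun s : S => (s, π s))).comp (measurable_pi_apply _))

instance [DiscreteMeasurableSpace S] (M : MDP S A) (π : S → A) (n : ℕ) :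
    IsMarkovKernel (M.stepKernel π n) := by
  unfold stepKernel
  infer_instance

/-- The law of the state trajectory `(sₜ)` with `s₀ = s` under the policy `π`
(Ionescu-Tulcea). -/
noncomputable def trajectoryLaw [DiscreteMeasurableSpace S] (M : MDP S A) (π : S → A) (s : S) :
    Measure (ℕ → S) :=
  Kernel.traj (X := fun _ : ℕ => S) (M.stepKernel π) 0 (fun _ => s)

/-- The value `v^π(s)`: the expected total discounted cost of the policy `π` started at `s`. -/
noncomputable def policyValue [DiscreteMeasurableSpace S] (M : MDP S A) (π : S → A) (s : S) : ℝ :=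
  ∫ x, ∑' t : ℕ, M.γ ^ t * M.c (x t) (π (x t)) ∂(M.trajectoryLaw π s)

/-- The action-value function `q^π` of the policy `π`. -/
noncomputable def policyQ [DiscreteMeasurableSpace S] (M : MDP S A) (π : S → A) : S × A → ℝ :=
  fun sa => M.c sa.1 sa.2 + M.γ * ∫ s', M.policyValue π s' ∂(M.P sa)

/-- The optimal Q-function `q^⋆ = min_π q^π`; for finite `S` and finite nonempty `A` the infimum
is over a finite nonempty family. -/
noncomputable def optimalQ [DiscreteMeasurableSpace S] (M : MDP S A) : S × A → ℝ :=
  fun sa => ⨅ π : S → A, M.policyQ π sa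

/-- The sampled Bellman optimality operator: `sNext (s, a)` is a sampled successor state of the
pair `(s, a)`. -/
noncomputable def sampledBellman (M : MDP S A) (q : S × A → ℝ) (sNext : S × A → S) : S × A → ℝ :=
  fun sa => M.c sa.1 sa.2 + M.γ * ⨅ a' : A, q (sNext sa, a')

end MDP

/-- The radial clipping `B_ρ(p) = (min {ρ, ‖p‖_∞} / ‖p‖_∞) p` (equal to `0` at `p = 0`); the norm
on a finite product of copies of `ℝ` is the `∞`-norm. -/
noncomputable def clip {ι : Type*} [Fintype ι] (ρ : ℝ) (p : ι → ℝ) : ι → ℝ :=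
  (min ρ ‖p‖ / ‖p‖) • p

/-!
The proof works along single sample paths, because the iterates `q k` may anticipate the samples
(neither the initial vector nor the directions `b k` are adapted, or even measurable), so that no
martingale argument can be applied to them.

Since the state space is finite, the sampled Bellman operator is the exact one plus a noise which is
linear in the vector of minimal values `V q = min_a q(·, a)`:
`sampledBellman q σ = bellman q + noiseOperator σ (V q)` (`MDP.sampledBellman_eq`). The entries of
`noiseOperator (ς k)` are centred, bounded, independent over `k`, and do not involve the iterates.
As `∑ α k ^ 2 < ∞`, the series `∑ α k • noiseOperator (ς k)` converges almost surely
(`ae_exists_tendsto_sum_noiseOperator`), and this is the only place where probability enters.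

Fix a path on which the series converges, and let `R k` be its tail. By Abel summation the
shifted iterate `z k = q k + R k (V (q k))` satisfies
`z (k + 1) = z k + α k • (bellman (z k) - z k + e k)` with `‖e k‖ ≤ ε k * (1 + ‖z k‖)`, `ε k → 0`;
the safeguarded corrections, of norm at most `|β k| ρ`, are part of `e k`. Because the Bellman
operator is a `γ`-contraction, for large `k` the distance of `z k` to its fixed point shrinks by a
factor `1 - α k (1 - γ) / 2` up to a summand `o(α k)`, and hence tends to zero; no separate proof
that the iterates are bounded is needed (`tendsto_fixedPoint_of_noisy_iteration`).

The fixed point is the optimal Q-function (`MDP.bellman_optimalQ`): every policy satisfies its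
evaluation equation (`MDP.policyValue_eq`, from the Markov property of the trajectory law), so a
maximum principle bounds every `q^π` from below by the fixed point, with equality for the policy
which is greedy with respect to it.
-/

/-! ### Convergence of random series -/

/-- A series of independent centred square-integrable random variables with summable variances
converges almost surely: its partial sums form an `L²`-bounded martingale. -/
theorem ae_exists_tendsto_sum_of_iIndepFun {Ω : Type*} [MeasurableSpace Ω] {μ : Measure Ω}
    [IsProbabilityMeasure μ] {X : ℕ → Ω → ℝ} (hX : ∀ k, Measurable (X k))
    (hL2 : ∀ k, MemLp (X k) 2 μ) (hindep : iIndepFun X μ) (hmean : ∀ k, ∫ ω, X k ω ∂μ = 0)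
    (hvar : Summable fun k => Var[X k; μ]) :
    ∀ᵐ ω ∂μ, ∃ l, Tendsto (fun n => ∑ k ∈ Finset.range n, X k ω) atTop (𝓝 l) := by
  have hXs : ∀ k, StronglyMeasurable (X k) := fun k => (hX k).stronglyMeasurable
  have hint : ∀ k, Integrable (X k) μ := fun k => (hL2 k).integrable (by norm_num)
  let ℱ := Filtration.natural X hXs
  let f : ℕ → Ω → ℝ := fun n => ∑ k ∈ Finset.range (n + 1), X k
  have hfint : ∀ n, Integrable (f n) μ := fun n => integrable_finsetSum' _ fun k _ => hint k
  have hadp : StronglyAdapted ℱ f := fun n =>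
    Finset.stronglyMeasurable_sum _ fun k hk =>
      (Filtration.stronglyAdapted_natural hXs k).mono
        (ℱ.mono (Nat.lt_succ_iff.1 (Finset.mem_range.1 hk)))
  have hmart : Martingale f ℱ μ := by
    refine martingale_nat hadp hfint fun n => ?_
    have h1 : μ[f (n + 1) | ℱ n] =ᵐ[μ] μ[f n | ℱ n] + μ[X (n + 1) | ℱ n] := by
      have : f (n + 1) = f n + X (n + 1) := Finset.sum_range_succ _ _
      rw [this]
      exact condExp_add (hfint n) (hint _) _
    have h2 := hindep.condExp_natural_ae_eq_of_lt hXs (Nat.lt_succ_self n)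
    have h3 : μ[f n | ℱ n] = f n := condExp_of_stronglyMeasurable (ℱ.le n) (hadp n) (hfint n)
    filter_upwards [h1, h2] with ω h1 h2
    rw [h1, Pi.add_apply, h3]
    change f n ω = f n ω + (μ[X (n + 1) | Filtration.natural X hXs n]) ω
    rw [h2, hmean, add_zero]
  have hf2 : ∀ n, MemLp (f n) 2 μ := fun n => memLp_finsetSum' _ fun k _ => hL2 k
  have hbdd : ∀ n, eLpNorm (f n) 1 μ ≤
      (Real.toNNReal (1 + ∑' k, Var[X k; μ]) : NNReal) := by
    intro n
    have hmean_f : ∫ ω, f n ω ∂μ = 0 := by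
      simp only [f, Finset.sum_apply]
      rw [integral_finsetSum _ fun k _ => hint k]
      simp [hmean]
    have hsq : ∫ ω, f n ω ^ 2 ∂μ ≤ ∑' k, Var[X k; μ] := by
      rw [← variance_of_integral_eq_zero (hf2 n).aemeasurable hmean_f,
        IndepFun.variance_sum (fun k _ => hL2 k) (fun i _ j _ hij => hindep.indepFun hij)]
      exact hvar.sum_le_tsum _ fun k _ => variance_nonneg _ _
    rw [eLpNorm_one_eq_lintegral_enorm, ← ofReal_integral_norm_eq_lintegral_enorm (hfint n)]
    refine ENNReal.ofReal_le_ofReal ?_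
    calc ∫ ω, ‖f n ω‖ ∂μ ≤ ∫ ω, (1 + f n ω ^ 2) ∂μ := by
          refine integral_mono (hfint n).norm ((integrable_const _).add (hf2 n).integrable_sq) ?_
          intro ω
          simp only [Real.norm_eq_abs]
          nlinarith [sq_abs (f n ω), sq_nonneg (|f n ω| - 1)]
      _ = 1 + ∫ ω, f n ω ^ 2 ∂μ := by
          rw [integral_add (integrable_const _) (hf2 n).integrable_sq]
          simp
      _ ≤ _ := by linarith
  filter_upwards [hmart.submartingale.ae_tendsto_limitProcess hbdd] with ω hω
  refine ⟨_, (tendsto_add_atTop_iff_nat 1).1 (hω.congr fun n => ?_)⟩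
  simp [f]

/-! ### Stochastic approximation along a single path -/

/-- A nonnegative sequence driven by `u (k + 1) ≤ (1 - c α k) u k + α k d k` with non-summable
step sizes and vanishing forcing `d` tends to zero. -/
theorem tendsto_zero_of_le_one_sub_mul_add {u α d : ℕ → ℝ} {c : ℝ} (hc : 0 < c)
    (hu : ∀ k, 0 ≤ u k) (hα : ∀ k, 0 ≤ α k) (hα0 : Tendsto α atTop (𝓝 0))
    (hαsum : Tendsto (fun n => ∑ k ∈ Finset.range n, α k) atTop atTop)
    (hd : Tendsto d atTop (𝓝 0))
    (hrec : ∀ᶠ k in atTop, u (k + 1) ≤ (1 - c * α k) * u k + α k * d k) :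
    Tendsto u atTop (𝓝 0) := by
  -- It suffices that the excess `w = (u - ε / 2)⁺` vanishes: it contracts by `1 - c α k`.
  rw [Metric.tendsto_atTop']
  intro ε hε
  have hα1 : ∀ᶠ k in atTop, c * α k < 1 :=
    (show Tendsto (fun k => c * α k) atTop (𝓝 0) by simpa using hα0.const_mul c).eventually
      (gt_mem_nhds one_pos)
  have hdε : ∀ᶠ k in atTop, d k < c * (ε / 2) := hd.eventually (gt_mem_nhds (by positivity))
  obtain ⟨K, hK⟩ := eventually_atTop.1 (hrec.and (hα1.and hdε))
  set w : ℕ → ℝ := fun k => max (u k - ε / 2) 0 with hw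
  have hw0 : ∀ k, 0 ≤ w k := fun k => le_max_right _ _
  have hstep : ∀ k, K ≤ k → w (k + 1) ≤ Real.exp (-(c * α k)) * w k := by
    intro k hk
    obtain ⟨h1, h2, h3⟩ := hK k hk
    have h4 : w (k + 1) ≤ (1 - c * α k) * w k := by
      refine max_le ?_ (mul_nonneg (by linarith) (hw0 k))
      have h5 := mul_le_mul_of_nonneg_left (le_max_left (u k - ε / 2) 0)
        (show 0 ≤ 1 - c * α k by linarith)
      have h6 := mul_le_mul_of_nonneg_left h3.le (hα k)
      simp only [hw]
      linarith
    refine h4.trans (mul_le_mul_of_nonneg_right ?_ (hw0 k))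
    linarith [Real.add_one_le_exp (-(c * α k))]
  have hprod : ∀ n, K ≤ n → w n ≤
      Real.exp (-(c * (∑ k ∈ Finset.range n, α k - ∑ k ∈ Finset.range K, α k))) * w K := by
    intro n hn
    induction n, hn using Nat.le_induction with
    | base => simp
    | succ n hn ih =>
      refine (hstep n hn).trans ((mul_le_mul_of_nonneg_left ih (Real.exp_pos _).le).trans_eq ?_)
      rw [← mul_assoc, ← Real.exp_add, Finset.sum_range_succ]
      ring_nf
  have hlim : Tendsto (fun n => Real.exp (-(c * (∑ k ∈ Finset.range n, α k -
      ∑ k ∈ Finset.range K, α k))) * w K) atTop (𝓝 0) := by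
    have : Tendsto (fun n => c * (∑ k ∈ Finset.range n, α k -
        ∑ k ∈ Finset.range K, α k)) atTop atTop :=
      (tendsto_atTop_add_const_right _ _ hαsum).const_mul_atTop hc
    simpa using (Real.tendsto_exp_neg_atTop_nhds_zero.comp this).mul_const (w K)
  obtain ⟨N, hN⟩ := eventually_atTop.1
    ((hlim.eventually (gt_mem_nhds (half_pos hε))).and (eventually_ge_atTop K))
  refine ⟨N, fun n hn => ?_⟩
  obtain ⟨h1, h2⟩ := hN n hn.le
  have h3 := (hprod n h2).trans_lt h1
  have h4 : u n - ε / 2 ≤ w n := le_max_left _ _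
  rw [Real.dist_eq, sub_zero, abs_of_nonneg (hu n)]
  linarith

/-- Damped fixed-point iteration of a contraction `T`, perturbed by a vanishing term `f k` and by a
multiplicative noise `L k (V (q k))`. The noise operators need not vanish, only the series
`∑ α k • L k` has to converge. -/
theorem tendsto_fixedPoint_of_noisy_iteration {E F : Type*} [NormedAddCommGroup E]
    [NormedSpace ℝ E] [NormedAddCommGroup F] [NormedSpace ℝ F] {T : E → E} {V : E → F} {γ : ℝ}
    (hγ1 : γ < 1) (hT : ∀ x y, ‖T x - T y‖ ≤ γ * ‖x - y‖)
    (hV : ∀ x y, ‖V x - V y‖ ≤ ‖x - y‖) (hV0 : V 0 = 0) {x₀ : E} (hx₀ : T x₀ = x₀)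
    {α : ℕ → ℝ} (hα : ∀ k, 0 ≤ α k) (hα0 : Tendsto α atTop (𝓝 0))
    (hαsum : Tendsto (fun n => ∑ k ∈ Finset.range n, α k) atTop atTop)
    {L : ℕ → F →L[ℝ] E} {C : ℝ} (hL : ∀ k, ‖L k‖ ≤ C) {l : F →L[ℝ] E}
    (hl : Tendsto (fun n => ∑ k ∈ Finset.range n, α k • L k) atTop (𝓝 l))
    {f : ℕ → E} (hf : Tendsto f atTop (𝓝 0)) {q : ℕ → E}
    (hq : ∀ k, q (k + 1) = q k + α k • (T (q k) - q k + L k (V (q k)) + f k)) :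
    Tendsto q atTop (𝓝 x₀) := by
  have hC : 0 ≤ C := (norm_nonneg _).trans (hL 0)
  -- The tails of the noise series.
  set R : ℕ → F →L[ℝ] E := fun n => l - ∑ k ∈ Finset.range n, α k • L k with hR
  have hR0 : Tendsto R atTop (𝓝 0) := by simpa using hl.const_sub l
  have hRstep : ∀ k, α k • L k = R k - R (k + 1) := by
    intro k
    simp only [hR, Finset.sum_range_succ]
    abel
  -- Abel summation: shifting `q` by `R k (V (q k))` turns the noise into a small perturbation.
  set z : ℕ → E := fun k => q k + R k (V (q k)) with hz
  have hzstep : ∀ k, z (k + 1) - x₀ = (1 - α k) • (z k - x₀) + α k • (T (z k) - T x₀) +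
      α k • ((T (q k) - T (z k)) - (q k - z k) + f k) +
      R (k + 1) (V (q (k + 1)) - V (q k)) := by
    intro k
    have h1 : α k • L k (V (q k)) = R k (V (q k)) - R (k + 1) (V (q k)) := by
      have := congrArg (fun A : F →L[ℝ] E => A (V (q k))) (hRstep k)
      simpa using this
    have h2 : z (k + 1) = q k + α k • (T (q k) - q k + f k) + α k • L k (V (q k)) +
        R (k + 1) (V (q (k + 1))) := by
      change q (k + 1) + R (k + 1) (V (q (k + 1))) = _
      congr 1
      rw [hq k]
      module
    rw [h2, h1, map_sub, hx₀]
    have h3 : R k (V (q k)) = z k - q k := by simp [hz]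
    rw [h3]
    module
  have hVn : ∀ x, ‖V x‖ ≤ ‖x‖ := fun x => by simpa [hV0] using hV x 0
  have hr0 : Tendsto (fun k => ‖R k‖) atTop (𝓝 0) := by simpa using hR0.norm
  have hr1 : Tendsto (fun k => ‖R (k + 1)‖) atTop (𝓝 0) := (tendsto_add_atTop_iff_nat 1).2 hr0
  have hf0 : Tendsto (fun k => ‖f k‖) atTop (𝓝 0) := by simpa using hf.norm
  have hzq : ∀ k, ‖q k - z k‖ ≤ ‖R k‖ * (‖q k - x₀‖ + ‖x₀‖) := by
    intro k
    have h1 : q k - z k = -(R k (V (q k))) := by simp [hz]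
    have h2 : ‖q k‖ ≤ ‖q k - x₀‖ + ‖x₀‖ := by
      simpa using norm_add_le (q k - x₀) x₀
    rw [h1, norm_neg]
    exact ((R k).le_opNorm _).trans
      (mul_le_mul_of_nonneg_left ((hVn _).trans h2) (norm_nonneg _))
  have hqz : ∀ᶠ k in atTop, ‖q k - x₀‖ ≤ 2 * ‖z k - x₀‖ + ‖x₀‖ := by
    filter_upwards [hr0.eventually (gt_mem_nhds (show (0 : ℝ) < 1 / 3 by norm_num))] with k hk
    have h1 : ‖q k - x₀‖ ≤ ‖q k - z k‖ + ‖z k - x₀‖ := by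
      simpa using norm_add_le (q k - z k) (z k - x₀)
    have h2 := mul_le_mul_of_nonneg_right hk.le
      (add_nonneg (norm_nonneg (q k - x₀)) (norm_nonneg x₀))
    linarith [hzq k, norm_nonneg x₀, norm_nonneg (z k - x₀)]
  set d : ℕ → ℝ := fun k => 4 * ‖R k‖ * ‖x₀‖ + ‖f k‖ +
    ‖R (k + 1)‖ * (2 * (2 + C) * ‖x₀‖ + ‖f k‖) with hd
  have hd0 : Tendsto d atTop (𝓝 0) := by
    have := (((hr0.const_mul 4).mul_const ‖x₀‖).add hf0).add
      (hr1.mul (hf0.const_add (2 * (2 + C) * ‖x₀‖)))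
    simpa using this
  have heps : ∀ᶠ k in atTop, 4 * ‖R k‖ + 2 * (2 + C) * ‖R (k + 1)‖ < (1 - γ) / 2 := by
    have : Tendsto (fun k => 4 * ‖R k‖ + 2 * (2 + C) * ‖R (k + 1)‖) atTop (𝓝 0) := by
      simpa using (hr0.const_mul 4).add (hr1.const_mul (2 * (2 + C)))
    exact this.eventually (gt_mem_nhds (by linarith))
  have hzlim : Tendsto (fun k => ‖z k - x₀‖) atTop (𝓝 0) := by
    refine tendsto_zero_of_le_one_sub_mul_add (c := (1 - γ) / 2) (by linarith)
      (fun k => norm_nonneg _) hα hα0 hαsum hd0 ?_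
    filter_upwards [hqz, heps, hα0.eventually (gt_mem_nhds one_pos)] with k hy he ha
    have ha0 := hα k
    set u := ‖z k - x₀‖
    set y := ‖q k - x₀‖
    set m := ‖x₀‖
    have hu0 : 0 ≤ u := norm_nonneg _
    have hm0 : 0 ≤ m := norm_nonneg _
    have hqn : ‖q k‖ ≤ y + m := by
      simpa using norm_add_le (q k - x₀) x₀
    have hr0' : 0 ≤ ‖R k‖ := norm_nonneg _
    have hr1' : 0 ≤ ‖R (k + 1)‖ := norm_nonneg _
    have hzq' : ‖q k - z k‖ ≤ ‖R k‖ * (2 * u + 2 * m) :=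
      (hzq k).trans (mul_le_mul_of_nonneg_left (by linarith) hr0')
    have hpert : ‖(T (q k) - T (z k)) - (q k - z k) + f k‖ ≤
        2 * (‖R k‖ * (2 * u + 2 * m)) + ‖f k‖ := by
      have h1 := norm_add_le ((T (q k) - T (z k)) - (q k - z k)) (f k)
      have h2 := norm_sub_le (T (q k) - T (z k)) (q k - z k)
      have h3 := (hT (q k) (z k)).trans (mul_le_of_le_one_left (norm_nonneg _) hγ1.le)
      linarith
    have hincr : ‖V (q (k + 1)) - V (q k)‖ ≤ α k * ((2 + C) * (2 * u + 2 * m) + ‖f k‖) := by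
      refine (hV _ _).trans ?_
      have h0 : q (k + 1) - q k =
          α k • ((T (q k) - T x₀) - (q k - x₀) + L k (V (q k)) + f k) := by
        rw [hq k, hx₀]
        module
      rw [h0, norm_smul, Real.norm_of_nonneg ha0]
      refine mul_le_mul_of_nonneg_left ?_ ha0
      have h1 := norm_add_le ((T (q k) - T x₀) - (q k - x₀) + L k (V (q k))) (f k)
      have h2 := norm_add_le ((T (q k) - T x₀) - (q k - x₀)) (L k (V (q k)))
      have h3 := norm_sub_le (T (q k) - T x₀) (q k - x₀)
      have h4 := (hT (q k) x₀).trans (mul_le_of_le_one_left (norm_nonneg _) hγ1.le)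
      have h5 : ‖L k (V (q k))‖ ≤ C * (2 * u + 2 * m) :=
        ((L k).le_opNorm _).trans (mul_le_mul (hL k) ((hVn _).trans (by linarith))
          (norm_nonneg _) hC)
      linarith
    rw [hzstep k]
    have n1 := norm_add_le ((1 - α k) • (z k - x₀) + α k • (T (z k) - T x₀) +
      α k • ((T (q k) - T (z k)) - (q k - z k) + f k)) (R (k + 1) (V (q (k + 1)) - V (q k)))
    have n2 := norm_add_le ((1 - α k) • (z k - x₀) + α k • (T (z k) - T x₀))
      (α k • ((T (q k) - T (z k)) - (q k - z k) + f k))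
    have n3 := norm_add_le ((1 - α k) • (z k - x₀)) (α k • (T (z k) - T x₀))
    have e1 : ‖(1 - α k) • (z k - x₀)‖ = (1 - α k) * u := by
      rw [norm_smul, Real.norm_of_nonneg (by linarith)]
    have e2 : ‖α k • (T (z k) - T x₀)‖ ≤ α k * (γ * u) := by
      rw [norm_smul, Real.norm_of_nonneg ha0]
      exact mul_le_mul_of_nonneg_left (hT _ _) ha0
    have e3 : ‖α k • ((T (q k) - T (z k)) - (q k - z k) + f k)‖ ≤
        α k * (2 * (‖R k‖ * (2 * u + 2 * m)) + ‖f k‖) := by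
      rw [norm_smul, Real.norm_of_nonneg ha0]
      exact mul_le_mul_of_nonneg_left hpert ha0
    have e4 : ‖R (k + 1) (V (q (k + 1)) - V (q k))‖ ≤
        ‖R (k + 1)‖ * (α k * ((2 + C) * (2 * u + 2 * m) + ‖f k‖)) :=
      ((R (k + 1)).le_opNorm _).trans (mul_le_mul_of_nonneg_left hincr hr1')
    have e5 := mul_le_mul_of_nonneg_left he.le (mul_nonneg ha0 hu0)
    have e6 : (1 - α k) * u + α k * (γ * u) + α k * (2 * (‖R k‖ * (2 * u + 2 * m)) + ‖f k‖) +
        ‖R (k + 1)‖ * (α k * ((2 + C) * (2 * u + 2 * m) + ‖f k‖)) =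
        (1 - α k * (1 - γ)) * u + α k * u * (4 * ‖R k‖ + 2 * (2 + C) * ‖R (k + 1)‖) +
        α k * d k := by
      simp only [hd]
      ring
    linarith
  -- Finally `‖q k - z k‖ ≤ ‖R k‖ (2 ‖z k - x₀‖ + 2 ‖x₀‖) → 0`.
  rw [tendsto_iff_norm_sub_tendsto_zero]
  have hbound : Tendsto (fun k => ‖R k‖ * (2 * ‖z k - x₀‖ + 2 * ‖x₀‖) + ‖z k - x₀‖) atTop
      (𝓝 0) := by
    simpa using (hr0.mul ((hzlim.const_mul 2).add_const (2 * ‖x₀‖))).add hzlim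
  refine squeeze_zero' (Eventually.of_forall fun k => norm_nonneg _) ?_ hbound
  filter_upwards [hqz] with k hk
  have h1 : ‖q k - x₀‖ ≤ ‖q k - z k‖ + ‖z k - x₀‖ := by
    simpa using norm_add_le (q k - z k) (z k - x₀)
  have h2 := (hzq k).trans (mul_le_mul_of_nonneg_left
    (show ‖q k - x₀‖ + ‖x₀‖ ≤ 2 * ‖z k - x₀‖ + 2 * ‖x₀‖ by linarith) (norm_nonneg (R k)))
  linarith

/-! ### Discounted Markov decision processes -/

theorem abs_ciInf_sub_ciInf_le {ι : Type*} [Finite ι] [Nonempty ι] {f g : ι → ℝ} {C : ℝ}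
    (h : ∀ i, |f i - g i| ≤ C) : |(⨅ i, f i) - ⨅ i, g i| ≤ C := by
  have hf : BddBelow (Set.range f) := (Set.finite_range f).bddBelow
  have hg : BddBelow (Set.range g) := (Set.finite_range g).bddBelow
  have h1 : (⨅ i, f i) - C ≤ ⨅ i, g i := le_ciInf fun i => by
    linarith [ciInf_le hf i, (abs_le.1 (h i)).2]
  have h2 : (⨅ i, g i) - C ≤ ⨅ i, f i := le_ciInf fun i => by
    linarith [ciInf_le hg i, (abs_le.1 (h i)).1]
  exact abs_le.2 ⟨by linarith, by linarith⟩

/-- The pointwise minimum over actions of a Q-function. -/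
noncomputable def minOverActions {S A : Type*} (q : S × A → ℝ) (s : S) : ℝ := ⨅ a : A, q (s, a)

theorem norm_minOverActions_sub_le {S A : Type*} [Fintype S] [Fintype A] [Nonempty A]
    (q q' : S × A → ℝ) : ‖minOverActions q - minOverActions q'‖ ≤ ‖q - q'‖ :=
  (pi_norm_le_iff_of_nonneg (norm_nonneg _)).2 fun s =>
    abs_ciInf_sub_ciInf_le fun a => norm_le_pi_norm (q - q') (s, a)

namespace MDP

variable {S A : Type*} [MeasurableSpace S] [MeasurableSpace A]

/-- The Bellman optimality operator. -/
noncomputable def bellman (M : MDP S A) (q : S × A → ℝ) : S × A → ℝ :=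
  fun sa => M.c sa.1 sa.2 + M.γ * ∫ s', minOverActions q s' ∂(M.P sa)

/-- The transition operator of the Markov chain induced by the policy `π`. -/
noncomputable def policyTransition (M : MDP S A) (π : S → A) (g : S → ℝ) : S → ℝ :=
  fun s => ∫ s', g s' ∂(M.P (s, π s))

variable [Fintype S] [DiscreteMeasurableSpace S]

theorem norm_bellman_sub_le [Fintype A] [Nonempty A] (M : MDP S A) (q q' : S × A → ℝ) :
    ‖M.bellman q - M.bellman q'‖ ≤ M.γ * ‖q - q'‖ := by
  refine (pi_norm_le_iff_of_nonneg (mul_nonneg M.γ_pos.le (norm_nonneg _))).2 fun sa => ?_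
  have h1 : (M.bellman q - M.bellman q') sa =
      M.γ * ∫ s', (minOverActions q - minOverActions q') s' ∂(M.P sa) := by
    simp only [bellman, Pi.sub_apply]
    rw [integral_sub .of_finite .of_finite]
    ring
  rw [h1, norm_mul, Real.norm_of_nonneg M.γ_pos.le]
  refine mul_le_mul_of_nonneg_left ?_ M.γ_pos.le
  have := norm_integral_le_of_norm_le_const (μ := M.P sa)
    (f := minOverActions q - minOverActions q') (C := ‖q - q'‖)
    (Eventually.of_forall fun s' => (norm_le_pi_norm _ s').trans (norm_minOverActions_sub_le q q'))
  simpa using this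

theorem exists_bellman_fixedPoint [Fintype A] [Nonempty A] (M : MDP S A) :
    ∃ q : S × A → ℝ, M.bellman q = q := by
  have h : ContractingWith ⟨M.γ, M.γ_pos.le⟩ M.bellman :=
    ⟨M.γ_lt_one, LipschitzWith.of_dist_le_mul fun q q' => by
      rw [dist_eq_norm, dist_eq_norm]
      exact M.norm_bellman_sub_le q q'⟩
  exact ⟨_, h.fixedPoint_isFixedPt⟩

/-- Maximum principle: a function which is at most the discounted average of its successors
is nonpositive. -/
theorem nonpos_of_le_discounted_integral [Finite A] (M : MDP S A) (π : S → A) {h : S × A → ℝ}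
    (hh : ∀ sa, h sa ≤ M.γ * ∫ s', h (s', π s') ∂(M.P sa)) (sa : S × A) : h sa ≤ 0 := by
  have : Nonempty (S × A) := ⟨sa⟩
  obtain ⟨m, hm⟩ := Finite.exists_max h
  refine (hm sa).trans ?_
  have h1 : ∫ s', h (s', π s') ∂(M.P m) ≤ h m := by
    have := integral_mono (μ := M.P m) (f := fun s' => h (s', π s')) (g := fun _ => h m)
      .of_finite .of_finite (fun s' => hm _)
    simpa using this
  have h2 := (hh m).trans (mul_le_mul_of_nonneg_left h1 M.γ_pos.le)
  nlinarith [M.γ_lt_one]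

theorem integrable_comp_eval (μ : Measure (ℕ → S)) [IsFiniteMeasure μ] (g : S → ℝ) (t : ℕ) :
    Integrable (fun x => g (x t)) μ :=
  (Integrable.of_finite (μ := μ.map fun x => x t) (f := g)).comp_measurable
    (f := fun x : ℕ → S => x t) (measurable_pi_apply t)

instance (M : MDP S A) (π : S → A) (s : S) : IsProbabilityMeasure (M.trajectoryLaw π s) := by
  unfold trajectoryLaw
  infer_instance

/-- The law of the `t`-th state: expectations are iterates of the transition operator. -/
theorem integral_trajectoryLaw_eval (M : MDP S A) (π : S → A) (s : S) (t : ℕ) (g : S → ℝ) :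
    ∫ x, g (x t) ∂(M.trajectoryLaw π s) = (M.policyTransition π)^[t] g s := by
  induction t generalizing g with
  | zero =>
    unfold trajectoryLaw
    rw [Kernel.integral_traj _ (integrable_comp_eval _ g 0).aestronglyMeasurable]
    simp [Function.updateFinset]
  | succ t ih =>
    rw [Function.iterate_succ_apply, ← ih]
    unfold trajectoryLaw
    set x₀ : (i : Finset.Iic 0) → (fun _ : ℕ => S) i := fun _ => s
    set κ := M.stepKernel π
    have hg : Measurable g := .of_discrete
    have hG : Measurable (M.policyTransition π g) := .of_discrete
    -- Markov property: given the history up to time `t`, the next state has law `κ t`.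
    have h1 := Kernel.partialTraj_compProd_eq_map_traj (X := fun _ : ℕ => S) (κ := κ)
      (Nat.zero_le t) (x₀ := x₀)
    have h2 : ∫ x, g (x (t + 1)) ∂(Kernel.traj (X := fun _ : ℕ => S) κ 0 x₀) =
        ∫ y : ((i : Finset.Iic t) → (fun _ : ℕ => S) i) × S, g y.2
          ∂((Kernel.traj (X := fun _ : ℕ => S) κ 0 x₀).map
            fun x => (Preorder.frestrictLe t x, x (t + 1))) :=
      (integral_map
        (φ := fun x : ℕ → S => (Preorder.frestrictLe (π := fun _ : ℕ => S) t x, x (t + 1)))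
        (f := fun y : ((i : Finset.Iic t) → (fun _ : ℕ => S) i) × S => g y.2)
        (Measurable.aemeasurable (by fun_prop))
        (hg.comp measurable_snd).aestronglyMeasurable).symm
    have h3 : Integrable (fun y : ((i : Finset.Iic t) → (fun _ : ℕ => S) i) × S => g y.2)
        ((Kernel.partialTraj (X := fun _ : ℕ => S) κ 0 t x₀) ⊗ₘ (κ t)) :=
      (Integrable.of_finite (f := g)).comp_measurable measurable_snd
    have h4 : ∀ h : (i : Finset.Iic t) → (fun _ : ℕ => S) i, ∫ s', g s' ∂(κ t h) =
        M.policyTransition π g (h ⟨t, Finset.mem_Iic.2 le_rfl⟩) := by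
      intro h
      rw [policyTransition]
      rfl
    rw [h2, ← h1, Measure.integral_compProd h3, ← Kernel.traj_map_frestrictLe,
      Kernel.map_apply _ (by fun_prop), integral_map (by fun_prop)]
    · simp only [h4]
      rfl
    · simp only [h4]
      exact (hG.comp (measurable_pi_apply _)).aestronglyMeasurable

/-- The policy evaluation equation. -/
theorem policyValue_eq (M : MDP S A) (π : S → A) (s : S) :
    M.policyValue π s = M.policyQ π (s, π s) := by
  set g : S → ℝ := fun s => M.c s (π s) with hg
  have hγ0 := M.γ_pos.le
  have hbound : ∀ (t : ℕ) (s : S), ‖(M.policyTransition π)^[t] g s‖ ≤ ‖g‖ := by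
    intro t
    induction t with
    | zero => exact fun s => norm_le_pi_norm g s
    | succ t ih =>
      intro s
      rw [Function.iterate_succ_apply']
      have := norm_integral_le_of_norm_le_const (μ := M.P (s, π s)) (Eventually.of_forall ih)
      simpa [policyTransition] using this
  have hgeom : Summable fun t : ℕ => M.γ ^ t * ‖g‖ :=
    (summable_geometric_of_lt_one hγ0 M.γ_lt_one).mul_right _
  have hsum : ∀ s, Summable fun t : ℕ => M.γ ^ t * (M.policyTransition π)^[t] g s := fun s =>
    Summable.of_norm_bounded hgeom fun t => by
      rw [norm_mul, Real.norm_of_nonneg (pow_nonneg hγ0 t)]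
      exact mul_le_mul_of_nonneg_left (hbound t s) (pow_nonneg hγ0 t)
  have hval : ∀ s, M.policyValue π s = ∑' t : ℕ, M.γ ^ t * (M.policyTransition π)^[t] g s := by
    intro s
    unfold policyValue
    rw [← integral_tsum_of_summable_integral_norm
      (F := fun (t : ℕ) (x : ℕ → S) => M.γ ^ t * M.c (x t) (π (x t)))]
    · refine tsum_congr fun t => ?_
      rw [integral_const_mul, ← integral_trajectoryLaw_eval]
    · exact fun t => (integrable_comp_eval _ g t).const_mul _
    · refine Summable.of_nonneg_of_le (fun t => integral_nonneg fun x => norm_nonneg _)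
        (fun t => ?_) hgeom
      have := integral_mono (μ := M.trajectoryLaw π s)
        (((integrable_comp_eval (M.trajectoryLaw π s) g t).const_mul (M.γ ^ t)).norm)
        (integrable_const (M.γ ^ t * ‖g‖)) (fun x => by
          rw [norm_mul, Real.norm_of_nonneg (pow_nonneg hγ0 t)]
          exact mul_le_mul_of_nonneg_left (norm_le_pi_norm g _) (pow_nonneg hγ0 t))
      simpa using this
  have hint : ∫ s', M.policyValue π s' ∂(M.P (s, π s)) =
      ∑' t : ℕ, M.γ ^ t * (M.policyTransition π)^[t + 1] g s := by
    simp only [hval, integral_fintype Integrable.of_finite, smul_eq_mul,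
      Function.iterate_succ_apply']
    simp only [policyTransition, ← tsum_mul_left]
    rw [← Summable.tsum_finsetSum fun s' _ => (hsum s').mul_left _]
    refine tsum_congr fun t => ?_
    rw [integral_fintype Integrable.of_finite, Finset.mul_sum]
    refine Finset.sum_congr rfl fun s' _ => ?_
    rw [smul_eq_mul]
    exact mul_left_comm _ _ _
  rw [policyQ, hint, hval, (hsum s).tsum_eq_zero_add, ← tsum_mul_left]
  simp [hg, pow_succ', mul_assoc]

/-- Bellman's optimality equation for `q^⋆`. -/
theorem bellman_optimalQ [Fintype A] [Nonempty A] (M : MDP S A) :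
    M.bellman M.optimalQ = M.optimalQ := by
  obtain ⟨q, hq⟩ := M.exists_bellman_fixedPoint
  have hpol : ∀ (π : S → A) sa, M.policyQ π sa =
      M.c sa.1 sa.2 + M.γ * ∫ s', M.policyQ π (s', π s') ∂(M.P sa) := fun π sa => by
    simp only [← policyValue_eq]
    rfl
  have hfix : ∀ sa, q sa = M.c sa.1 sa.2 + M.γ * ∫ s', minOverActions q s' ∂(M.P sa) :=
    fun sa => (congrFun hq sa).symm
  have hlower : ∀ (π : S → A) sa, q sa ≤ M.policyQ π sa := by
    intro π sa
    refine sub_nonpos.1 (M.nonpos_of_le_discounted_integral π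
      (h := fun sa => q sa - M.policyQ π sa) (fun sa => ?_) sa)
    rw [integral_sub .of_finite .of_finite, hfix sa, hpol π sa]
    have h1 : ∫ s', minOverActions q s' ∂(M.P sa) ≤ ∫ s', q (s', π s') ∂(M.P sa) :=
      integral_mono .of_finite .of_finite fun s' =>
        ciInf_le (f := fun a => q (s', a)) (Set.finite_range _).bddBelow (π s')
    linarith [mul_le_mul_of_nonneg_left h1 M.γ_pos.le]
  -- The policy that is greedy for the fixed point attains the lower bound.
  choose π hπ using fun s : S => Finite.exists_min fun a : A => q (s, a)
  have hgreedy : ∀ s, minOverActions q s = q (s, π s) := fun s =>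
    le_antisymm (ciInf_le (f := fun a => q (s, a)) (Set.finite_range _).bddBelow (π s))
      (le_ciInf (hπ s))
  have hupper : ∀ sa, M.policyQ π sa ≤ q sa := by
    intro sa
    refine sub_nonpos.1 (M.nonpos_of_le_discounted_integral π
      (h := fun sa => M.policyQ π sa - q sa) (fun sa => ?_) sa)
    rw [integral_sub .of_finite .of_finite, hfix sa, hpol π sa]
    simp only [hgreedy]
    linarith
  have hopt : M.optimalQ = q := by
    funext sa
    have : Nonempty (S → A) := ⟨π⟩
    refine le_antisymm ?_ (le_ciInf fun π' => hlower π' sa)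
    exact (ciInf_le (Set.finite_range fun π' : S → A => M.policyQ π' sa).bddBelow π).trans
      (hupper sa)
  rw [hopt, hq]

end MDP

/-! ### The sampling noise and the conclusion -/

theorem norm_clip_le {ι : Type*} [Fintype ι] {ρ : ℝ} (hρ : 0 ≤ ρ) (p : ι → ℝ) :
    ‖clip ρ p‖ ≤ ρ := by
  rw [clip, norm_smul, Real.norm_of_nonneg (by positivity)]
  rcases eq_or_ne ‖p‖ 0 with h | h
  · simpa [h] using hρ
  · rw [div_mul_cancel₀ _ h]
    exact min_le_left _ _

namespace MDP

variable {S A : Type*} [MeasurableSpace S] [MeasurableSpace A]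

open Classical in
/-- The deviation of the empirical law of one sample from the transition law: the entry at
`((s, a), s')` is `1{sNext (s, a) = s'} - P(s' | s, a)`. -/
noncomputable def sampleDeviation (M : MDP S A) (sNext : S × A → S) (i : (S × A) × S) : ℝ :=
  (if sNext i.1 = i.2 then 1 else 0) - (M.P i.1).real {i.2}

theorem abs_sampleDeviation_le (M : MDP S A) (sNext : S × A → S) (i : (S × A) × S) :
    |M.sampleDeviation sNext i| ≤ 1 := by
  have h0 : 0 ≤ (M.P i.1).real {i.2} := measureReal_nonneg
  have h1 : (M.P i.1).real {i.2} ≤ 1 := measureReal_le_one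
  unfold sampleDeviation
  split_ifs <;> exact abs_le.2 ⟨by linarith, by linarith⟩

variable [Fintype S] [Fintype A]

/-- The elementary operator `v ↦ v(s') e_{(s, a)}` from value functions to Q-functions. -/
noncomputable def matrixUnit (i : (S × A) × S) : (S → ℝ) →L[ℝ] (S × A → ℝ) :=
  open Classical in (ContinuousLinearMap.proj i.2 : (S → ℝ) →L[ℝ] ℝ).smulRight (Pi.single i.1 1)

/-- The operator through which the sampling noise of one iteration acts on value functions. -/
noncomputable def noiseOperator (M : MDP S A) (sNext : S × A → S) :
    (S → ℝ) →L[ℝ] (S × A → ℝ) :=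
  ∑ i, (M.γ * M.sampleDeviation sNext i) • matrixUnit i

theorem noiseOperator_apply (M : MDP S A) (sNext : S × A → S) (v : S → ℝ) (sa : S × A) :
    M.noiseOperator sNext v sa = M.γ * ∑ s', M.sampleDeviation sNext (sa, s') * v s' := by
  classical
  simp only [noiseOperator, matrixUnit, sum_apply, Finset.sum_apply,
    smul_apply, ContinuousLinearMap.smulRight_apply,
    ContinuousLinearMap.proj_apply, Pi.smul_apply, smul_eq_mul, Pi.single_apply]
  rw [Fintype.sum_prod_type, Finset.sum_eq_single sa, Finset.mul_sum]
  · exact Finset.sum_congr rfl fun s' _ => by simp [mul_assoc]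
  · intro b _ hb
    exact Finset.sum_eq_zero fun s' _ => by simp [hb.symm]
  · simp

theorem sampledBellman_eq [DiscreteMeasurableSpace S] (M : MDP S A) (q : S × A → ℝ)
    (sNext : S × A → S) :
    M.sampledBellman q sNext = M.bellman q + M.noiseOperator sNext (minOverActions q) := by
  funext sa
  rw [Pi.add_apply, noiseOperator_apply]
  simp only [sampledBellman, bellman, sampleDeviation, integral_fintype Integrable.of_finite,
    smul_eq_mul, sub_mul, Finset.sum_sub_distrib, ite_mul, one_mul, zero_mul, minOverActions]
  rw [Fintype.sum_eq_single (sNext sa) fun s hs => if_neg hs.symm, if_pos rfl]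
  ring

theorem norm_noiseOperator_le (M : MDP S A) (sNext : S × A → S) :
    ‖M.noiseOperator sNext‖ ≤ ∑ i : (S × A) × S, ‖(matrixUnit i : (S → ℝ) →L[ℝ] (S × A → ℝ))‖ := by
  refine norm_sum_le_of_le _ fun i _ => ?_
  rw [norm_smul]
  refine mul_le_of_le_one_left (norm_nonneg _) ?_
  rw [norm_mul, Real.norm_of_nonneg M.γ_pos.le]
  exact mul_le_one₀ M.γ_lt_one.le (norm_nonneg _) (M.abs_sampleDeviation_le sNext i)

end MDP

/-- The series of weighted sampling noise converges almost surely. This involves the samples only, and so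
holds simultaneously for all iterates, however these depend on the samples. -/
theorem ae_exists_tendsto_sum_noiseOperator {S A Ω : Type*}
    [Fintype S] [MeasurableSpace S] [DiscreteMeasurableSpace S]
    [Fintype A] [MeasurableSpace A] [DiscreteMeasurableSpace A]
    [MeasurableSpace Ω] {μ : Measure Ω} [IsProbabilityMeasure μ] (M : MDP S A)
    {ς : ℕ → Ω → (S × A → S)} (hς_meas : ∀ k, Measurable (ς k))
    (hς_law : ∀ k sa, μ.map (fun ω => ς k ω sa) = M.P sa) (hς_indep : iIndepFun ς μ)
    {α : ℕ → ℝ} (hα_sq : Summable (fun k => α k ^ 2)) :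
    ∀ᵐ ω ∂μ, ∃ l, Tendsto (fun n => ∑ k ∈ Finset.range n, α k • M.noiseOperator (ς k ω))
      atTop (𝓝 l) := by
  classical
  have hmeasD : ∀ i, Measurable fun σ : S × A → S => M.sampleDeviation σ i := fun i =>
    (Measurable.of_discrete (f := fun s : S => (if s = i.2 then (1 : ℝ) else 0) -
      (M.P i.1).real {i.2})).comp (measurable_pi_apply i.1)
  have hscalar : ∀ i, ∀ᵐ ω ∂μ, ∃ l, Tendsto
      (fun n => ∑ k ∈ Finset.range n, α k * M.sampleDeviation (ς k ω) i) atTop (𝓝 l) := by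
    intro i
    have hmeas : ∀ k, Measurable fun ω => α k * M.sampleDeviation (ς k ω) i := fun k =>
      ((hmeasD i).comp (hς_meas k)).const_mul _
    have hbd : ∀ k ω, |α k * M.sampleDeviation (ς k ω) i| ≤ |α k| := fun k ω => by
      rw [abs_mul]
      exact mul_le_of_le_one_right (abs_nonneg _) (M.abs_sampleDeviation_le _ _)
    have hL2 : ∀ k, MemLp (fun ω => α k * M.sampleDeviation (ς k ω) i) 2 μ := fun k =>
      MemLp.of_bound (hmeas k).aestronglyMeasurable |α k| (Eventually.of_forall (hbd k))
    refine ae_exists_tendsto_sum_of_iIndepFun hmeas hL2 ?_ ?_ ?_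
    · exact hς_indep.comp (fun k σ => α k * M.sampleDeviation σ i)
        fun k => (hmeasD i).const_mul _
    · intro k
      rw [integral_const_mul]
      have hc : Measurable fun ω => ς k ω i.1 := (measurable_pi_apply i.1).comp (hς_meas k)
      have h1 : ∀ g : S → ℝ, ∫ ω, g (ς k ω i.1) ∂μ = ∫ s, g s ∂(M.P i.1) := fun g => by
        rw [← hς_law k i.1, integral_map hc.aemeasurable
          (Measurable.of_discrete).aestronglyMeasurable]
      have h2 : ∫ ω, M.sampleDeviation (ς k ω) i ∂μ =
          ∫ s, ((if s = i.2 then (1 : ℝ) else 0) - (M.P i.1).real {i.2}) ∂(M.P i.1) := by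
        rw [← h1]
        simp only [MDP.sampleDeviation]
      rw [h2, integral_sub .of_finite .of_finite, integral_const,
        integral_fintype Integrable.of_finite]
      simp
    · refine Summable.of_nonneg_of_le (fun k => variance_nonneg _ _) (fun k => ?_) hα_sq
      refine (variance_le_expectation_sq (hmeas k).aestronglyMeasurable).trans ?_
      have := integral_mono (hL2 k).integrable_sq (integrable_const (α k ^ 2))
        (fun ω => sq_le_sq.2 (hbd k ω))
      simpa using this
  filter_upwards [ae_all_iff.2 hscalar] with ω hω
  choose l hl using hω
  refine ⟨∑ i, (M.γ * l i) • MDP.matrixUnit i, ?_⟩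
  refine (tendsto_finsetSum Finset.univ fun i _ =>
    ((hl i).const_mul M.γ).smul_const (MDP.matrixUnit i)).congr fun n => ?_
  simp only [MDP.noiseOperator, Finset.smul_sum, Finset.mul_sum, Finset.sum_smul, smul_smul]
  rw [Finset.sum_comm]
  refine Finset.sum_congr rfl fun k _ => Finset.sum_congr rfl fun i _ => ?_
  rw [mul_left_comm]

theorem mainTheorem1 {S A Ω : Type*}
    [Fintype S] [MeasurableSpace S] [DiscreteMeasurableSpace S]
    [Fintype A] [Nonempty A] [MeasurableSpace A] [DiscreteMeasurableSpace A]
    [MeasurableSpace Ω] (μ : Measure Ω) [IsProbabilityMeasure μ]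
    (M : MDP S A)
    -- the vectors of sampled next states: independent over the iterations
    (ς : ℕ → Ω → (S × A → S))
    (hς_meas : ∀ k, Measurable (ς k))
    (hς_law : ∀ k sa, μ.map (fun ω => ς k ω sa) = M.P sa)
    (hς_indep : iIndepFun ς μ)
    (ρ : ℝ) (hρ : 0 < ρ)
    (α β : ℕ → ℝ)
    (hα_nonneg : ∀ k, 0 ≤ α k)
    (hα_sum : Tendsto (fun n => ∑ k ∈ Finset.range n, α k) atTop atTop)
    (hα_sq : Summable (fun k => α k ^ 2))
    (hβ : Tendsto β atTop (𝓝 0))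
    -- arbitrary (random) novel directions, correction terms and iterates
    (b p q : ℕ → Ω → (S × A → ℝ))
    (hp : ∀ k ω, p k ω = b k ω + q k ω - M.sampledBellman (q k ω) (ς k ω))
    (hq : ∀ k ω, q (k + 1) ω = q k ω +
      α k • (M.sampledBellman (q k ω) (ς k ω) - q k ω + β k • clip ρ (p k ω))) :
    ∀ᵐ ω ∂μ, Tendsto (fun k => q k ω) atTop (𝓝 M.optimalQ) := by
  have hα0 : Tendsto α atTop (𝓝 0) := by
    have h := hα_sq.tendsto_atTop_zero.sqrt
    simpa [Real.sqrt_sq (hα_nonneg _)] using h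
  filter_upwards [ae_exists_tendsto_sum_noiseOperator M hς_meas hς_law hς_indep hα_sq]
    with ω ⟨l, hl⟩
  refine tendsto_fixedPoint_of_noisy_iteration (V := minOverActions) M.γ_lt_one
    M.norm_bellman_sub_le norm_minOverActions_sub_le ?_ M.bellman_optimalQ hα_nonneg hα0 hα_sum
    (fun k => M.norm_noiseOperator_le (ς k ω)) hl (f := fun k => β k • clip ρ (p k ω)) ?_ ?_
  · funext s
    simp [minOverActions]
  · -- The safeguarded correction is at most `|β k| ρ`, whatever the direction `p k` is.
    refine squeeze_zero_norm (a := fun k => |β k| * ρ) (fun k => ?_) ?_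
    · rw [norm_smul]
      exact mul_le_mul_of_nonneg_left (norm_clip_le hρ.le _) (norm_nonneg _)
    · simpa using hβ.abs.mul_const ρ
  · intro k
    rw [hq k ω, M.sampledBellman_eq]
    congr 2
    abel
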